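/- Let $m\ge 1$ and let $S_j(x)=\rho x+d_j$ ($j=0,\dots,m$) be pairwise distinct similarities of $\mathbb{R}$ with a common contraction factor $0<\rho<1$ whose self-similar set (the unique non-empty compact $K$ with $K=\bigcup_j S_j(K)$) is $K=[0,1]$. Assume that the system is of finite type: there is a finite set $F\subset\mathbb{R}$ such that for all $n$ and all words $v,w$ of length $n$ over $\{0,\dots,m\}$, either $|S_v(0)-S_w(0)|>\operatorname{diam}(K)\,\rho^{n}$ or $\rho^{-n}|S_v(0)-S_w(0)|\in F$, where $S_{j_1\cdots j_n}=S_{j_1}\circ\dots\circ S_{j_n}$. Let $p_j>0$ with $\sum_j p_j=1$, and assume regularity: the probabilities attached to the left-most and the right-most of the maps $S_j$ are equal and are minimal among all $p_j$. Let $\mu$ be the associated self-similar measure, i.e. the Borel probability measure on $\mathbb{R}$ with $\mu(E)=\sum_j p_j\,\mu(S_j^{-1}(E))$ for all Borel sets $E$. A dimension function is a map $\Phi:(0,1)\to[0,\infty)$ such that $x^{1+\Phi(x)}$ decreases to $0$ as $x$ decreases to $0$. The upper $\Phi$-dimension $\overline{\dim}_\Phi\mu$ is the infimum of all $\alpha\in\mathbb{R}$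 for which there are $C_1,C_2>0$ such that $$\frac{\mu(B(x,R))}{\mu(B(x,r))}\le C_2\Big(\frac{R}{r}\Big)^{\alpha}\qquad\text{for all }x\in\operatorname{supp}\mu\text{ and all }0<r<R^{1+\Phi(R)}\le R\le C_1,\ R<1,$$ where $B(x,R)$ denotes the open ball (and $\inf\emptyset=\infty$). Then $\overline{\dim}_\Phi\mu$ is finite for every dimension function $\Phi$ for which there is a constant $c>0$ with $$\frac{\log|\log x|}{|\log x|}\le c\,\Phi(x)\qquad\text{for all }x\in(0,1).$$ In particular, the quasi-Assouad dimension $\dim_{qA}\mu=\lim_{\theta\to1^-}\overline{\dim}_{\Phi_\theta}\mu$, where $\Phi_\theta$ is the constant function $1/\theta-1$, exists and is finite. -/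

import Mathlib

open Set Filter Topology MeasureTheory

namespace PhiDim

noncomputable section

/-! ### Dimension functions and dimensions of measures -/

/-- A dimension function: `Φ ≥ 0` on `(0,1)` and `x ^ (1 + Φ x)` decreases to `0` as `x`
decreases to `0`. Only the values of `Φ` on `(0,1)` matter. -/
structure IsDimensionFunction (Φ : ℝ → ℝ) : Prop where
  nonneg : ∀ x ∈ Ioo (0 : ℝ) 1, 0 ≤ Φ x
  monotoneOn : MonotoneOn (fun x : ℝ => x ^ (1 + Φ x)) (Ioo 0 1)
  tendsto_zero : Tendsto (fun x : ℝ => x ^ (1 + Φ x)) (𝓝[>] 0) (𝓝 0)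

/-- `f ⪯ g` on `s`: there is a constant `c` with `f x ≤ c * g x` for all `x ∈ s`. -/
def DominatedOn (f g : ℝ → ℝ) (s : Set ℝ) : Prop :=
  ∃ c : ℝ, 0 < c ∧ ∀ x ∈ s, f x ≤ c * g x

/-- The set of exponents `α` admissible in the definition of the upper `Φ`-dimension of `μ`. -/
def upperPhiExponents {X : Type*} [PseudoMetricSpace X] [MeasurableSpace X]
    (Φ : ℝ → ℝ) (μ : Measure X) : Set ℝ :=
  {α : ℝ | ∃ C₁ C₂ : ℝ, 0 < C₁ ∧ 0 < C₂ ∧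
    ∀ r R : ℝ, 0 < r → r < R ^ (1 + Φ R) → R ^ (1 + Φ R) ≤ R → R ∈ Ioo (0 : ℝ) 1 → R ≤ C₁ →
      ∀ x ∈ μ.support,
        μ.real (Metric.ball x R) / μ.real (Metric.ball x r) ≤ C₂ * (R / r) ^ α}

/-- The upper `Φ`-dimension of `μ`, an extended real number (`⊤` if no exponent is admissible). -/
def upperPhiDim {X : Type*} [PseudoMetricSpace X] [MeasurableSpace X]
    (Φ : ℝ → ℝ) (μ : Measure X) : EReal :=
  sInf ((fun α : ℝ => (α : EReal)) '' upperPhiExponents Φ μ)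

/-- `t` is the (upper) quasi-Assouad dimension of `μ`, that is, the limit as `θ → 1`, `θ < 1`,
of the upper dimensions of `μ` with respect to the constant functions `1 / θ - 1`. -/
def HasQuasiAssouadDim {X : Type*} [PseudoMetricSpace X] [MeasurableSpace X]
    (μ : Measure X) (t : EReal) : Prop :=
  Tendsto (fun θ : ℝ => upperPhiDim (fun _ => 1 / θ - 1) μ) (𝓝[<] 1) (𝓝 t)

/-! ### Equicontractive iterated function systems on the line -/

/-- The similarity `S_j x = ρ x + d_j`. -/
def simMap {m : ℕ} (ρ : ℝ) (d : Fin (m + 1) → ℝ) (j : Fin (m + 1)) (x : ℝ) : ℝ :=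
  ρ * x + d j

/-- `S_w = S_{j₁} ∘ ⋯ ∘ S_{jₙ}` for the word `w = [j₁, …, jₙ]`. -/
def wordMap {m : ℕ} (ρ : ℝ) (d : Fin (m + 1) → ℝ) : List (Fin (m + 1)) → ℝ → ℝ
  | [], x => x
  | j :: w, x => simMap ρ d j (wordMap ρ d w x)

/-- `K` is the self-similar set of the system: nonempty, compact and `K = ⋃ j, S_j(K)`. -/
def IsSelfSimilarSet {m : ℕ} (ρ : ℝ) (d : Fin (m + 1) → ℝ) (K : Set ℝ) : Prop :=
  K.Nonempty ∧ IsCompact K ∧ K = ⋃ j, simMap ρ d j '' K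

/-- Finite type, for a system with self-similar set `K`. -/
def IsFiniteType {m : ℕ} (ρ : ℝ) (d : Fin (m + 1) → ℝ) (K : Set ℝ) : Prop :=
  ∃ F : Set ℝ, F.Finite ∧ ∀ (n : ℕ) (v w : List (Fin (m + 1))), v.length = n → w.length = n →
    Metric.diam K * ρ ^ n < |wordMap ρ d v 0 - wordMap ρ d w 0| ∨
      (ρ ^ n)⁻¹ * |wordMap ρ d v 0 - wordMap ρ d w 0| ∈ F

/-- Regularity: the probabilities of the left-most and of the right-most contraction are equal
and minimal. -/
def IsRegular {m : ℕ} (d p : Fin (m + 1) → ℝ) : Prop :=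
  ∃ a b : Fin (m + 1), (∀ j, d a ≤ d j) ∧ (∀ j, d j ≤ d b) ∧ p a = p b ∧ ∀ j, p a ≤ p j

/-- `μ` is self-similar: `μ(E) = ∑ j, p_j μ(S_j⁻¹(E))` for all Borel sets `E`. -/
def IsSelfSimilarMeasure {m : ℕ} (ρ : ℝ) (d p : Fin (m + 1) → ℝ) (μ : Measure ℝ) : Prop :=
  ∀ E : Set ℝ, MeasurableSet E → μ E = ∑ j, ENNReal.ofReal (p j) * μ (simMap ρ d j ⁻¹' E)

end

end PhiDim

/-!
Give a word `w` the weight `p_w`. For `x ∈ (0, 1)` compare the total weights `L_n(x)` and `R_n(x)`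
of the words `w` of length `n` with `x ∈ S_w((0, 1])`, respectively `x ∈ S_w([0, 1))`. They differ
only through words such that `x` is an end point of `S_w([0, 1])`. From some letter on, such a word
repeats the extreme map fixing that end point, so by regularity this tail of length `k` has weight
`q ^ k`, where `q` is the minimal probability; but `L_k, R_k ≥ q ^ k` by minimality. Induction on
`n` turns this into the statement that `L_n` and `R_n` agree up to the factor `1 + n / q`.

The function `R_n` is a step function with left-continuous version `L_n` and jumps at end points of
level `n`. Finite type bounds by some `N` the number of those in an interval of length `ρ ^ n`, so
`R_n` changes by a factor of at most `(1 + n / q) ^ N` over such a distance. As `μ(B(x, ρ ^ n))` is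
comparable to values of `R_n` near `x`, and `R_(n+k) ≥ q ^ k R_n`, the measure satisfies
`μ(B(x, R)) ≤ C |log R| ^ K (R / r) ^ s μ(B(x, r))`. If `r < R ^ (1 + Φ(R))`, then
`R / r > R ^ (-Φ(R))`, and the growth condition on `Φ` says exactly that a power of this absorbs
`|log R| ^ K`.
-/

namespace PhiDim

/-! ### Weights of words covering a point -/

section Transfer

variable {ι X : Type*} [Fintype ι] (T : ι → X → X) (p : ι → ℝ)

/-- The transfer operator `g ↦ ∑ j, p j • (g ∘ T j)`. The `T j` stand for the inverse branches of
an iterated function system with probabilities `p j`. -/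
noncomputable def transfer : Module.End ℝ (X → ℝ) :=
  ∑ j, p j • LinearMap.funLeft ℝ ℝ (T j)

theorem transfer_pow_succ_apply (n : ℕ) (g : X → ℝ) (x : X) :
    (transfer T p ^ (n + 1)) g x = ∑ j, p j * (transfer T p ^ n) g (T j x) := by
  simp [pow_succ', transfer]

variable {T p}

theorem transfer_pow_mono (hp : ∀ j, 0 ≤ p j) (n : ℕ) : Monotone (transfer T p ^ n) := by
  intro g h hgh
  induction n with
  | zero => exact hgh
  | succ n ih =>
    intro x
    simp only [transfer_pow_succ_apply]
    exact Finset.sum_le_sum fun j _ => mul_le_mul_of_nonneg_left (ih _) (hp j)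

variable (T p)

/-- The total weight of the words `w` of length `n` for which `x` lies in the `w`-th copy of `s`
under the iterated function system with inverse branches `T j`. -/
noncomputable def coverWeight (s : Set X) (n : ℕ) : X → ℝ :=
  (transfer T p ^ n) (s.indicator 1)

theorem coverWeight_zero (s : Set X) : coverWeight T p s 0 = s.indicator 1 := rfl

theorem coverWeight_succ (s : Set X) (n : ℕ) (x : X) :
    coverWeight T p s (n + 1) x = ∑ j, p j * coverWeight T p s n (T j x) :=
  transfer_pow_succ_apply T p n _ x

variable {T p} {s t : Set X}

theorem coverWeight_nonneg (hp : ∀ j, 0 ≤ p j) (n : ℕ) (x : X) : 0 ≤ coverWeight T p s n x := by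
  have h : (0 : X → ℝ) ≤ s.indicator 1 := indicator_nonneg fun _ _ => zero_le_one
  have := transfer_pow_mono (T := T) hp n h x
  rwa [map_zero] at this

theorem coverWeight_eq_zero (hs : ∀ j x, T j x ∈ s → x ∈ s) (n : ℕ) {x : X} (hx : x ∉ s) :
    coverWeight T p s n x = 0 := by
  induction n generalizing x with
  | zero => exact indicator_of_notMem hx _
  | succ n ih =>
    rw [coverWeight_succ]
    exact Finset.sum_eq_zero fun j _ => by rw [ih fun h => hx (hs j x h), mul_zero]

theorem coverWeight_eq_pow_of_fixed (hs : ∀ j x, T j x ∈ s → x ∈ s) {x : X} (hx : x ∈ s) {b : ι}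
    (hb : T b x = x) (hne : ∀ j ≠ b, T j x ∉ s) (n : ℕ) : coverWeight T p s n x = p b ^ n := by
  induction n with
  | zero => exact indicator_of_mem hx _
  | succ n ih =>
    rw [coverWeight_succ, Finset.sum_eq_single_of_mem b (Finset.mem_univ b) fun j _ hj => by
      rw [coverWeight_eq_zero hs n (hne j hj), mul_zero], hb, ih, pow_succ']

theorem mul_coverWeight_le_coverWeight_succ (hp : ∀ j, 0 ≤ p j) (n : ℕ) (j : ι) (x : X) :
    p j * coverWeight T p s n (T j x) ≤ coverWeight T p s (n + 1) x := by
  rw [coverWeight_succ]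
  exact Finset.single_le_sum (f := fun i => p i * coverWeight T p s n (T i x))
    (fun i _ => mul_nonneg (hp i) (coverWeight_nonneg hp _ _)) (Finset.mem_univ j)

theorem pow_le_coverWeight {q : ℝ} (hq : 0 ≤ q) (hqp : ∀ j, q ≤ p j)
    (hs : ∀ x ∈ s, ∃ j, T j x ∈ s) (n : ℕ) {x : X} (hx : x ∈ s) :
    q ^ n ≤ coverWeight T p s n x := by
  induction n generalizing x with
  | zero => rw [pow_zero, coverWeight_zero, indicator_of_mem hx, Pi.one_apply]
  | succ n ih =>
    obtain ⟨j, hj⟩ := hs x hx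
    have hp : ∀ j, 0 ≤ p j := fun j => hq.trans (hqp j)
    calc q ^ (n + 1) = q * q ^ n := pow_succ' q n
      _ ≤ p j * coverWeight T p s n (T j x) :=
        mul_le_mul (hqp j) (ih hj) (pow_nonneg hq n) (hp j)
      _ ≤ coverWeight T p s (n + 1) x := mul_coverWeight_le_coverWeight_succ hp n j x

theorem pow_mul_coverWeight_le {q : ℝ} (hq : 0 ≤ q) (hqp : ∀ j, q ≤ p j)
    (hs : ∀ x ∈ s, ∃ j, T j x ∈ s) (n k : ℕ) (x : X) :
    q ^ k * coverWeight T p s n x ≤ coverWeight T p s (n + k) x := by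
  have hp : ∀ j, 0 ≤ p j := fun j => hq.trans (hqp j)
  have hk : q ^ k • s.indicator (1 : X → ℝ) ≤ coverWeight T p s k := by
    intro y
    by_cases hy : y ∈ s
    · simpa [hy] using pow_le_coverWeight hq hqp hs k hy
    · simpa [hy] using coverWeight_nonneg hp k y
  calc q ^ k * coverWeight T p s n x
      = (transfer T p ^ n) (q ^ k • s.indicator 1) x := by rw [map_smul]; rfl
    _ ≤ (transfer T p ^ n) (coverWeight T p s k) x := transfer_pow_mono hp n hk x
    _ = coverWeight T p s (n + k) x := by rw [coverWeight, coverWeight, pow_add]; rfl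

theorem coverWeight_congr {P : ℕ → X → X → Prop}
    (hzero : ∀ x y, P 0 x y → (x ∈ s ↔ y ∈ t))
    (hsucc : ∀ n j x y, P (n + 1) x y → P n (T j x) (T j y)) {n : ℕ} {x y : X} (h : P n x y) :
    coverWeight T p s n x = coverWeight T p t n y := by
  induction n generalizing x y with
  | zero =>
    rw [coverWeight_zero, coverWeight_zero]
    by_cases hy : y ∈ t
    · rw [indicator_of_mem hy, indicator_of_mem ((hzero x y h).2 hy), Pi.one_apply, Pi.one_apply]
    · rw [indicator_of_notMem hy, indicator_of_notMem (hy ∘ (hzero x y h).1)]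
  | succ n ih =>
    simp only [coverWeight_succ]
    exact Finset.sum_congr rfl fun j _ => by rw [ih (hsucc n j x y h)]

/-- Passing from `n` to `n + 1` costs at most `q ^ n`, the contribution of `s \ t`, while the
weight of `t` is at least `q ^ (n + 1)` by `pow_le_coverWeight`. -/
theorem coverWeight_le_one_add_div_mul {q : ℝ} (hq : 0 < q) (hqp : ∀ j, q ≤ p j)
    (hp1 : ∑ j, p j = 1) (hs : ∀ j x, T j x ∈ s → x ∈ s) (ht : ∀ x ∈ t, ∃ j, T j x ∈ t)
    (hst : ∀ n, ∀ x ∈ s \ t, coverWeight T p s n x ≤ q ^ n) (n : ℕ) {x : X} (hx : x ∈ t) :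
    coverWeight T p s n x ≤ (1 + n / q) * coverWeight T p t n x := by
  have hp : ∀ j, 0 ≤ p j := fun j => hq.le.trans (hqp j)
  induction n generalizing x with
  | zero =>
    rw [Nat.cast_zero, zero_div, add_zero, one_mul, coverWeight_zero, coverWeight_zero,
      indicator_of_mem hx]
    exact indicator_le_self' (fun _ _ => zero_le_one) x
  | succ n ih =>
    have hbranch : ∀ y, coverWeight T p s n y ≤ (1 + n / q) * coverWeight T p t n y + q ^ n := by
      intro y
      have hnonneg : 0 ≤ (1 + n / q) * coverWeight T p t n y :=
        mul_nonneg (by positivity) (coverWeight_nonneg hp n y)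
      by_cases hyt : y ∈ t
      · linarith [ih hyt, pow_pos hq n]
      by_cases hys : y ∈ s
      · linarith [hst n y ⟨hys, hyt⟩]
      · rw [coverWeight_eq_zero hs n hys]
        positivity
    calc coverWeight T p s (n + 1) x
        ≤ ∑ j, p j * ((1 + n / q) * coverWeight T p t n (T j x) + q ^ n) := by
          rw [coverWeight_succ]
          exact Finset.sum_le_sum fun j _ => mul_le_mul_of_nonneg_left (hbranch _) (hp j)
      _ = (1 + n / q) * coverWeight T p t (n + 1) x + q ^ (n + 1) / q := by
          simp only [mul_add, Finset.sum_add_distrib, ← Finset.sum_mul, hp1, coverWeight_succ,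
            Finset.mul_sum, mul_left_comm (p _), one_mul]
          rw [pow_succ, mul_div_cancel_right₀ _ hq.ne']
      _ ≤ (1 + n / q) * coverWeight T p t (n + 1) x + coverWeight T p t (n + 1) x / q := by
          gcongr
          exact pow_le_coverWeight hq.le hqp ht (n + 1) hx
      _ = (1 + ↑(n + 1) / q) * coverWeight T p t (n + 1) x := by
          push_cast
          ring

end Transfer

section HalfOpen

variable {ι α : Type*} [Finite ι] [LinearOrder α] [TopologicalSpace α] [OrderTopology α]
  [DenselyOrdered α] {f : ι → α → α} {a b : α}

theorem exists_mem_Ico_of_forall_mem_Icc (hf : ∀ i, Continuous (f i))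
    (hmono : ∀ i, StrictMono (f i)) (h : ∀ x ∈ Icc a b, ∃ i, f i x ∈ Icc a b) :
    ∀ x ∈ Ico a b, ∃ i, f i x ∈ Ico a b := by
  intro x hx
  by_contra! hout
  have hnear : ∀ i, ∀ᶠ y in 𝓝[>] x, f i y ∉ Icc a b := by
    intro i
    by_cases hi : f i x < a
    · filter_upwards [nhdsWithin_le_nhds ((hf i).continuousAt.eventually_lt_const hi)] with y hy
      exact fun h => hy.not_ge h.1
    · filter_upwards [self_mem_nhdsWithin] with y hy
      have hb : b ≤ f i x := not_lt.1 fun hb => hout i ⟨not_lt.1 hi, hb⟩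
      exact fun h => (hb.trans_lt (hmono i hy)).not_ge h.2
  have : (𝓝[>] x).NeBot := nhdsGT_neBot_of_exists_gt ⟨b, hx.2⟩
  obtain ⟨y, hy, hxy⟩ := ((eventually_all.2 hnear).and (Ioo_mem_nhdsGT hx.2)).exists
  obtain ⟨i, hi⟩ := h y ⟨hx.1.trans hxy.1.le, hxy.2.le⟩
  exact hy i hi

theorem exists_mem_Ioc_of_forall_mem_Icc (hf : ∀ i, Continuous (f i))
    (hmono : ∀ i, StrictMono (f i)) (h : ∀ x ∈ Icc a b, ∃ i, f i x ∈ Icc a b) :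
    ∀ x ∈ Ioc a b, ∃ i, f i x ∈ Ioc a b := by
  intro x hx
  obtain ⟨i, hi⟩ := exists_mem_Ico_of_forall_mem_Icc (α := αᵒᵈ) (a := OrderDual.toDual b)
    (b := OrderDual.toDual a) (f := f) hf (fun i => (hmono i).dual)
    (fun x hx => (h x hx.symm).imp fun _ => And.symm) x hx.symm
  exact ⟨i, hi.symm⟩

end HalfOpen

/-! ### Systems with self-similar set `[0, 1]` -/

section Similarities

variable {m : ℕ} {ρ : ℝ} {d : Fin (m + 1) → ℝ}

/-- The inverse `x ↦ (x - d j) / ρ` of the similarity `simMap ρ d j`. -/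
noncomputable def simMapInv (ρ : ℝ) (d : Fin (m + 1) → ℝ) (j : Fin (m + 1)) (x : ℝ) : ℝ :=
  (x - d j) / ρ

theorem simMap_simMapInv (hρ : ρ ≠ 0) (j : Fin (m + 1)) (x : ℝ) :
    simMap ρ d j (simMapInv ρ d j x) = x := by
  rw [simMap, simMapInv, mul_div_cancel₀ _ hρ, sub_add_cancel]

theorem simMapInv_simMap (hρ : ρ ≠ 0) (j : Fin (m + 1)) (x : ℝ) :
    simMapInv ρ d j (simMap ρ d j x) = x := by
  rw [simMap, simMapInv, add_sub_cancel_right, mul_div_cancel_left₀ _ hρ]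

theorem continuous_simMapInv (j : Fin (m + 1)) : Continuous (simMapInv ρ d j) := by
  unfold simMapInv
  fun_prop

theorem strictMono_simMapInv (hρ : 0 < ρ) (j : Fin (m + 1)) : StrictMono (simMapInv ρ d j) :=
  fun _ _ h => div_lt_div_of_pos_right (sub_lt_sub_right h _) hρ

theorem strictMono_simMap (hρ : 0 < ρ) (j : Fin (m + 1)) : StrictMono (simMap ρ d j) :=
  fun _ _ h => add_lt_add_left (mul_lt_mul_of_pos_left h hρ) _

namespace IsSelfSimilarSet

variable {K : Set ℝ}

theorem mapsTo_simMap (hK : IsSelfSimilarSet ρ d K) (j : Fin (m + 1)) :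
    MapsTo (simMap ρ d j) K K := fun x hx => by
  rw [hK.2.2]
  exact mem_iUnion_of_mem j (mem_image_of_mem _ hx)

theorem exists_simMapInv_mem (hK : IsSelfSimilarSet ρ d K) (hρ : ρ ≠ 0) :
    ∀ x ∈ K, ∃ j, simMapInv ρ d j x ∈ K := by
  intro x hx
  rw [hK.2.2] at hx
  obtain ⟨j, y, hy, rfl⟩ := mem_iUnion.1 hx
  exact ⟨j, by rwa [simMapInv_simMap hρ]⟩

variable (hK : IsSelfSimilarSet ρ d (Icc 0 1))
include hK

theorem exists_simMapInv_mem_Ico (hρ : 0 < ρ) :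
    ∀ x ∈ Ico (0 : ℝ) 1, ∃ j, simMapInv ρ d j x ∈ Ico (0 : ℝ) 1 :=
  exists_mem_Ico_of_forall_mem_Icc continuous_simMapInv (strictMono_simMapInv hρ)
    (hK.exists_simMapInv_mem hρ.ne')

theorem exists_simMapInv_mem_Ioc (hρ : 0 < ρ) :
    ∀ x ∈ Ioc (0 : ℝ) 1, ∃ j, simMapInv ρ d j x ∈ Ioc (0 : ℝ) 1 :=
  exists_mem_Ioc_of_forall_mem_Icc continuous_simMapInv (strictMono_simMapInv hρ)
    (hK.exists_simMapInv_mem hρ.ne')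

theorem simMap_zero_nonneg (j : Fin (m + 1)) : 0 ≤ simMap ρ d j 0 :=
  (hK.mapsTo_simMap j (left_mem_Icc.2 zero_le_one)).1

theorem simMap_one_le_one (j : Fin (m + 1)) : simMap ρ d j 1 ≤ 1 :=
  (hK.mapsTo_simMap j (right_mem_Icc.2 zero_le_one)).2

theorem mem_Ico_of_simMapInv_mem (hρ : 0 < ρ) (j : Fin (m + 1)) (x : ℝ)
    (hx : simMapInv ρ d j x ∈ Ico (0 : ℝ) 1) : x ∈ Ico (0 : ℝ) 1 := by
  rw [← simMap_simMapInv hρ.ne' (d := d) j x]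
  exact ⟨(hK.simMap_zero_nonneg j).trans ((strictMono_simMap hρ j).monotone hx.1),
    (strictMono_simMap hρ j hx.2).trans_le (hK.simMap_one_le_one j)⟩

theorem mem_Ioc_of_simMapInv_mem (hρ : 0 < ρ) (j : Fin (m + 1)) (x : ℝ)
    (hx : simMapInv ρ d j x ∈ Ioc (0 : ℝ) 1) : x ∈ Ioc (0 : ℝ) 1 := by
  rw [← simMap_simMapInv hρ.ne' (d := d) j x]
  exact ⟨(hK.simMap_zero_nonneg j).trans_lt (strictMono_simMap hρ j hx.1),
    ((strictMono_simMap hρ j).monotone hx.2).trans (hK.simMap_one_le_one j)⟩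

theorem simMap_leftmost_zero (hρ : 0 < ρ) {a : Fin (m + 1)} (ha : ∀ j, d a ≤ d j) :
    simMap ρ d a 0 = 0 := by
  obtain ⟨j, hj⟩ := hK.exists_simMapInv_mem hρ.ne' 0 (left_mem_Icc.2 zero_le_one)
  refine (hK.simMap_zero_nonneg a).antisymm' ?_
  calc simMap ρ d a 0 ≤ simMap ρ d j 0 := add_le_add_right (ha j) _
    _ ≤ simMap ρ d j (simMapInv ρ d j 0) := (strictMono_simMap hρ j).monotone hj.1
    _ = 0 := simMap_simMapInv hρ.ne' j 0

theorem simMap_rightmost_one (hρ : 0 < ρ) {b : Fin (m + 1)} (hb : ∀ j, d j ≤ d b) :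
    simMap ρ d b 1 = 1 := by
  obtain ⟨j, hj⟩ := hK.exists_simMapInv_mem hρ.ne' 1 (right_mem_Icc.2 zero_le_one)
  refine (hK.simMap_one_le_one b).antisymm ?_
  calc 1 = simMap ρ d j (simMapInv ρ d j 1) := (simMap_simMapInv hρ.ne' j 1).symm
    _ ≤ simMap ρ d j 1 := (strictMono_simMap hρ j).monotone hj.2
    _ ≤ simMap ρ d b 1 := add_le_add_right (hb j) _

end IsSelfSimilarSet

end Similarities

/-- The reals `a` and `b` bound each other up to the factor `c`. -/
def AgreeUpTo (c a b : ℝ) : Prop := a ≤ c * b ∧ b ≤ c * a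

namespace AgreeUpTo

variable {a b c c₁ c₂ e : ℝ}

theorem refl (hc : 1 ≤ c) (ha : 0 ≤ a) : AgreeUpTo c a a :=
  ⟨le_mul_of_one_le_left ha hc, le_mul_of_one_le_left ha hc⟩

theorem symm (h : AgreeUpTo c a b) : AgreeUpTo c b a := And.symm h

theorem trans (hc₁ : 0 ≤ c₁) (hc₂ : 0 ≤ c₂) (hab : AgreeUpTo c₁ a b) (hbe : AgreeUpTo c₂ b e) :
    AgreeUpTo (c₁ * c₂) a e := by
  constructor
  · calc a ≤ c₁ * b := hab.1
      _ ≤ c₁ * (c₂ * e) := mul_le_mul_of_nonneg_left hbe.1 hc₁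
      _ = c₁ * c₂ * e := (mul_assoc _ _ _).symm
  · calc e ≤ c₂ * b := hbe.2
      _ ≤ c₂ * (c₁ * a) := mul_le_mul_of_nonneg_left hab.2 hc₂
      _ = c₁ * c₂ * a := by ring

end AgreeUpTo

/-- Here `f` is a step function with jumps in `E` and `g` is its left-continuous version, so a
comparison of `f` and `g` at the points of `E` bounds the effect of each jump. -/
theorem agreeUpTo_pow_of_encard_le {α : Type*} [LinearOrder α] {E : Set α} {f g : α → ℝ} {D : ℝ}
    (hD : 1 ≤ D) (hf : 0 ≤ f) (hright : ∀ x y, x ≤ y → Disjoint E (Ioc x y) → f x = f y)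
    (hleft : ∀ x y, x < y → Disjoint E (Ioo x y) → f x = g y) {k : ℕ} {x y : α} (hxy : x ≤ y)
    (hjump : ∀ e ∈ E ∩ Ioc x y, AgreeUpTo D (f e) (g e)) (hk : (E ∩ Ioc x y).encard ≤ k) :
    AgreeUpTo (D ^ k) (f x) (f y) := by
  induction k generalizing x with
  | zero =>
    rw [hright x y hxy (disjoint_iff_inter_eq_empty.2 (by simpa using hk))]
    exact AgreeUpTo.refl (one_le_pow₀ hD) (hf y)
  | succ k ih =>
    rcases (E ∩ Ioc x y).eq_empty_or_nonempty with hempty | hne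
    · rw [hright x y hxy (disjoint_iff_inter_eq_empty.2 hempty)]
      exact AgreeUpTo.refl (one_le_pow₀ hD) (hf y)
    obtain ⟨e, he, hmin⟩ := exists_min_image _ id (finite_of_encard_le_coe hk) hne
    have hxe : f x = g e := hleft x e he.2.1 <| disjoint_left.2 fun z hz hz' =>
      hz'.2.not_ge (hmin z ⟨hz, hz'.1, hz'.2.le.trans he.2.2⟩)
    have hsub : E ∩ Ioc e y ⊆ E ∩ Ioc x y :=
      inter_subset_inter_right _ (Ioc_subset_Ioc_left he.2.1.le)
    have hcard : (E ∩ Ioc e y).encard ≤ k := by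
      have hinsert : insert e (E ∩ Ioc e y) ⊆ E ∩ Ioc x y := insert_subset he hsub
      have := (encard_le_encard hinsert).trans hk
      rw [encard_insert_of_notMem fun h => h.2.1.false, Nat.cast_succ] at this
      exact (ENat.add_le_add_iff_right ENat.one_ne_top).1 this
    rw [hxe, pow_succ']
    exact (hjump e he).symm.trans (zero_le_one.trans hD) (by positivity)
      (ih he.2.2 (fun z hz => hjump z (hsub hz)) hcard)

namespace IsSelfSimilarSet

variable {m : ℕ} {ρ : ℝ} {d p : Fin (m + 1) → ℝ} (hK : IsSelfSimilarSet ρ d (Icc 0 1))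
  (hρ : 0 < ρ) (hd : Function.Injective d)
include hK hρ hd

theorem coverWeight_Ico_zero {a : Fin (m + 1)} (ha : ∀ j, d a ≤ d j) (n : ℕ) :
    coverWeight (simMapInv ρ d) p (Ico 0 1) n 0 = p a ^ n := by
  have hfix := hK.simMap_leftmost_zero hρ ha
  refine coverWeight_eq_pow_of_fixed (hK.mem_Ico_of_simMapInv_mem hρ)
    (left_mem_Ico.2 zero_lt_one) ?_ (fun j hj hmem => hj (hd (le_antisymm ?_ (ha j)))) n
  · conv_lhs => rw [← hfix, simMapInv_simMap hρ.ne']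
  · refine le_of_add_le_add_left (a := ρ * 0) ?_
    calc simMap ρ d j 0 ≤ simMap ρ d j (simMapInv ρ d j 0) :=
          (strictMono_simMap hρ j).monotone hmem.1
      _ = simMap ρ d a 0 := by rw [simMap_simMapInv hρ.ne', hfix]

theorem coverWeight_Ioc_one {b : Fin (m + 1)} (hb : ∀ j, d j ≤ d b) (n : ℕ) :
    coverWeight (simMapInv ρ d) p (Ioc 0 1) n 1 = p b ^ n := by
  have hfix := hK.simMap_rightmost_one hρ hb
  refine coverWeight_eq_pow_of_fixed (hK.mem_Ioc_of_simMapInv_mem hρ)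
    (right_mem_Ioc.2 zero_lt_one) ?_ (fun j hj hmem => hj (hd (le_antisymm (hb j) ?_))) n
  · conv_lhs => rw [← hfix, simMapInv_simMap hρ.ne']
  · refine le_of_add_le_add_left (a := ρ * 1) ?_
    calc simMap ρ d b 1 = simMap ρ d j (simMapInv ρ d j 1) := by
          rw [simMap_simMapInv hρ.ne', hfix]
      _ ≤ simMap ρ d j 1 := (strictMono_simMap hρ j).monotone hmem.2

theorem exists_agreeUpTo_coverWeight (hreg : IsRegular d p) (hp : ∀ j, 0 < p j)
    (hp1 : ∑ j, p j = 1) : ∃ q : ℝ, 0 < q ∧ (∀ j, q ≤ p j) ∧ ∀ n : ℕ, ∀ x ∈ Ioo (0 : ℝ) 1,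
      AgreeUpTo (1 + n / q) (coverWeight (simMapInv ρ d) p (Ico 0 1) n x)
        (coverWeight (simMapInv ρ d) p (Ioc 0 1) n x) := by
  obtain ⟨a, b, ha, hb, hab, hmin⟩ := hreg
  have hleft : ∀ x ∈ Ico (0 : ℝ) 1 \ Ioc 0 1, x = 0 := fun x hx =>
    le_antisymm (not_lt.1 fun h => hx.2 ⟨h, hx.1.2.le⟩) hx.1.1
  have hright : ∀ x ∈ Ioc (0 : ℝ) 1 \ Ico 0 1, x = 1 := fun x hx =>
    le_antisymm hx.1.2 (not_lt.1 fun h => hx.2 ⟨hx.1.1.le, h⟩)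
  refine ⟨p a, hp a, hmin, fun n x hx => ⟨?_, ?_⟩⟩
  · refine coverWeight_le_one_add_div_mul (hp a) hmin hp1 (hK.mem_Ico_of_simMapInv_mem hρ)
      (hK.exists_simMapInv_mem_Ioc hρ) (fun k y hy => ?_) n (Ioo_subset_Ioc_self hx)
    rw [hleft y hy, hK.coverWeight_Ico_zero hρ hd ha]
  · refine coverWeight_le_one_add_div_mul (hp a) hmin hp1 (hK.mem_Ioc_of_simMapInv_mem hρ)
      (hK.exists_simMapInv_mem_Ico hρ) (fun k y hy => ?_) n (Ioo_subset_Ico_self hx)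
    rw [hright y hy, hK.coverWeight_Ioc_one hρ hd hb, hab]

end IsSelfSimilarSet

section Endpoints

variable {m : ℕ} {ρ : ℝ} {d p : Fin (m + 1) → ℝ}

/-- The end points of the intervals `S_w([0, 1])`, for the words `w` of length `n`. -/
def levelEndpoints (ρ : ℝ) (d : Fin (m + 1) → ℝ) (n : ℕ) : Set ℝ :=
  {e | ∃ w : List (Fin (m + 1)), w.length = n ∧ (e = wordMap ρ d w 0 ∨ e = wordMap ρ d w 1)}

theorem zero_mem_levelEndpoints_zero : (0 : ℝ) ∈ levelEndpoints ρ d 0 :=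
  ⟨[], rfl, Or.inl rfl⟩

theorem one_mem_levelEndpoints_zero : (1 : ℝ) ∈ levelEndpoints ρ d 0 :=
  ⟨[], rfl, Or.inr rfl⟩

theorem simMap_mem_levelEndpoints {n : ℕ} {e : ℝ} (he : e ∈ levelEndpoints ρ d n)
    (j : Fin (m + 1)) : simMap ρ d j e ∈ levelEndpoints ρ d (n + 1) := by
  obtain ⟨w, rfl, rfl | rfl⟩ := he
  exacts [⟨j :: w, rfl, Or.inl rfl⟩, ⟨j :: w, rfl, Or.inr rfl⟩]

theorem wordMap_eq_wordMap_zero_add (w : List (Fin (m + 1))) (x : ℝ) :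
    wordMap ρ d w x = wordMap ρ d w 0 + ρ ^ w.length * x := by
  induction w with
  | nil => simp [wordMap]
  | cons j w ih =>
    simp only [wordMap, simMap, List.length_cons] at ih ⊢
    rw [ih]
    ring

theorem coverWeight_Ico_eq_of_disjoint (hρ : 0 < ρ) {n : ℕ} {x y : ℝ} (hxy : x ≤ y)
    (hE : Disjoint (levelEndpoints ρ d n) (Ioc x y)) :
    coverWeight (simMapInv ρ d) p (Ico 0 1) n x = coverWeight (simMapInv ρ d) p (Ico 0 1) n y := by
  refine coverWeight_congr (P := fun n x y => x ≤ y ∧ Disjoint (levelEndpoints ρ d n) (Ioc x y))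
    (fun x y h => ?_) (fun n j x y h => ⟨(strictMono_simMapInv hρ j).monotone h.1, ?_⟩) ⟨hxy, hE⟩
  · have h0 : ¬(x < 0 ∧ 0 ≤ y) := disjoint_left.1 h.2 zero_mem_levelEndpoints_zero
    have h1 : ¬(x < 1 ∧ 1 ≤ y) := disjoint_left.1 h.2 one_mem_levelEndpoints_zero
    grind
  · refine disjoint_left.2 fun e he hmem => disjoint_left.1 h.2 (simMap_mem_levelEndpoints he j) ?_
    rw [← simMap_simMapInv hρ.ne' (d := d) j x, ← simMap_simMapInv hρ.ne' (d := d) j y]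
    exact ⟨strictMono_simMap hρ j hmem.1, (strictMono_simMap hρ j).monotone hmem.2⟩

theorem coverWeight_Ico_eq_Ioc_of_disjoint (hρ : 0 < ρ) {n : ℕ} {x y : ℝ} (hxy : x < y)
    (hE : Disjoint (levelEndpoints ρ d n) (Ioo x y)) :
    coverWeight (simMapInv ρ d) p (Ico 0 1) n x = coverWeight (simMapInv ρ d) p (Ioc 0 1) n y := by
  refine coverWeight_congr (P := fun n x y => x < y ∧ Disjoint (levelEndpoints ρ d n) (Ioo x y))
    (fun x y h => ?_) (fun n j x y h => ⟨strictMono_simMapInv hρ j h.1, ?_⟩) ⟨hxy, hE⟩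
  · have h0 : ¬(x < 0 ∧ 0 < y) := disjoint_left.1 h.2 zero_mem_levelEndpoints_zero
    have h1 : ¬(x < 1 ∧ 1 < y) := disjoint_left.1 h.2 one_mem_levelEndpoints_zero
    grind
  · refine disjoint_left.2 fun e he hmem => disjoint_left.1 h.2 (simMap_mem_levelEndpoints he j) ?_
    rw [← simMap_simMapInv hρ.ne' (d := d) j x, ← simMap_simMapInv hρ.ne' (d := d) j y]
    exact ⟨strictMono_simMap hρ j hmem.1, strictMono_simMap hρ j hmem.2⟩

theorem encard_le_of_forall_abs_sub_mem {A F : Set ℝ} {c : ℝ} (hc : c ≠ 0)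
    (h : ∀ z ∈ A, ∀ w ∈ A, c * |z - w| ∈ F) : A.encard ≤ (F ∪ Neg.neg '' F).encard := by
  rcases A.eq_empty_or_nonempty with rfl | ⟨w, hw⟩
  · simp
  refine encard_le_encard_of_injOn (f := fun z => c * (z - w)) (fun z hz => ?_)
    fun z _ z' _ hzz' => sub_left_injective (mul_left_cancel₀ hc hzz')
  rcases abs_choice (z - w) with habs | habs
  · exact Or.inl (by simpa only [habs] using h z hz w hw)
  · exact Or.inr ⟨_, h z hz w hw, by rw [habs, mul_neg, neg_neg]⟩

theorem IsFiniteType.exists_encard_levelEndpoints_le (hft : IsFiniteType ρ d (Icc 0 1))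
    (hρ : 0 < ρ) : ∃ N : ℕ, ∀ (n : ℕ) (x y : ℝ), y - x ≤ ρ ^ n →
      (levelEndpoints ρ d n ∩ Ioc x y).encard ≤ N := by
  obtain ⟨F, hF, h⟩ := hft
  rw [Real.diam_Icc zero_le_one, sub_zero] at h
  have hfin := hF.union (hF.image Neg.neg)
  refine ⟨(F ∪ Neg.neg '' F).ncard + (F ∪ Neg.neg '' F).ncard, fun n x y hxy => ?_⟩
  have hcount : ∀ t, ({e | ∃ w : List (Fin (m + 1)), w.length = n ∧ e = wordMap ρ d w t} ∩
      Ioc x y).encard ≤ (F ∪ Neg.neg '' F).ncard := by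
    intro t
    rw [hfin.cast_ncard_eq]
    refine encard_le_of_forall_abs_sub_mem (inv_ne_zero (pow_pos hρ n).ne') ?_
    rintro _ ⟨⟨v, hv, rfl⟩, hvmem⟩ _ ⟨⟨w, hw, rfl⟩, hwmem⟩
    have hclose : |wordMap ρ d v t - wordMap ρ d w t| ≤ ρ ^ n :=
      abs_le.2 ⟨by linarith [hvmem.1, hwmem.2], by linarith [hvmem.2, hwmem.1]⟩
    rw [wordMap_eq_wordMap_zero_add v, wordMap_eq_wordMap_zero_add w, hv, hw,
      add_sub_add_right_eq_sub] at hclose ⊢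
    exact (h n v w hv hw).resolve_left (by rwa [one_mul, not_lt])
  refine (encard_le_encard ?_).trans ((encard_union_le _ _).trans
    ((add_le_add (hcount 0) (hcount 1)).trans_eq (Nat.cast_add _ _).symm))
  rintro e ⟨⟨w, hw, h0 | h1⟩, he⟩
  exacts [Or.inl ⟨⟨w, hw, h0⟩, he⟩, Or.inr ⟨⟨w, hw, h1⟩, he⟩]

theorem encard_inter_Ioc_le_mul {E : Set ℝ} {N : ℕ} {δ : ℝ}
    (h : ∀ x y, y - x ≤ δ → (E ∩ Ioc x y).encard ≤ N) (l : ℕ) {x y : ℝ} (hxy : y - x ≤ l * δ) :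
    (E ∩ Ioc x y).encard ≤ (l * N : ℕ) := by
  induction l generalizing y with
  | zero => simp [Ioc_eq_empty_of_le (show y ≤ x by simpa using hxy)]
  | succ l ih =>
    have hsub : E ∩ Ioc x y ⊆ E ∩ Ioc x (y - δ) ∪ E ∩ Ioc (y - δ) y := by
      rw [← inter_union_distrib_left]
      exact inter_subset_inter_right _ Ioc_subset_Ioc_union_Ioc
    push_cast at hxy
    calc (E ∩ Ioc x y).encard
        ≤ (E ∩ Ioc x (y - δ)).encard + (E ∩ Ioc (y - δ) y).encard :=
          (encard_le_encard hsub).trans (encard_union_le _ _)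
      _ ≤ (l * N : ℕ) + N := add_le_add (ih (by linarith)) (h _ _ (by linarith))
      _ = ((l + 1) * N : ℕ) := by rw [add_one_mul, Nat.cast_add]

theorem agreeUpTo_coverWeight_of_abs_sub_le (hρ : 0 < ρ) (hp : ∀ j, 0 ≤ p j) {n N : ℕ} {D δ : ℝ}
    (hD : 1 ≤ D) (hjump : ∀ e ∈ Ioo (0 : ℝ) 1,
      AgreeUpTo D (coverWeight (simMapInv ρ d) p (Ico 0 1) n e)
        (coverWeight (simMapInv ρ d) p (Ioc 0 1) n e))
    (hN : ∀ x y, y - x ≤ δ → (levelEndpoints ρ d n ∩ Ioc x y).encard ≤ N) (l : ℕ) {x y : ℝ}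
    (hx : x ∈ Ico (0 : ℝ) 1) (hy : y ∈ Ico (0 : ℝ) 1) (hxy : |x - y| ≤ l * δ) :
    AgreeUpTo (D ^ (l * N)) (coverWeight (simMapInv ρ d) p (Ico 0 1) n x)
      (coverWeight (simMapInv ρ d) p (Ico 0 1) n y) := by
  wlog hle : x ≤ y generalizing x y
  · exact (this hy hx (by rwa [abs_sub_comm]) (le_of_not_ge hle)).symm
  rw [abs_sub_comm] at hxy
  exact agreeUpTo_pow_of_encard_le hD (fun z => coverWeight_nonneg hp n z)
    (fun _ _ => coverWeight_Ico_eq_of_disjoint hρ)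
    (fun _ _ => coverWeight_Ico_eq_Ioc_of_disjoint hρ) hle
    (fun e he => hjump e ⟨hx.1.trans_lt he.2.1, he.2.2.trans_lt hy.2⟩)
    (encard_inter_Ioc_le_mul hN l ((le_abs_self _).trans hxy))

end Endpoints

/-! ### Measures of balls -/

section SelfSimilarMeasure

variable {m : ℕ} {ρ : ℝ} {d p : Fin (m + 1) → ℝ}

theorem simMap_preimage_closedBall (hρ : 0 < ρ) (j : Fin (m + 1)) (x r : ℝ) :
    simMap ρ d j ⁻¹' Metric.closedBall x (ρ * r) = Metric.closedBall (simMapInv ρ d j x) r := by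
  ext y
  have h : simMap ρ d j y - x = ρ * (y - simMapInv ρ d j x) := by
    nth_rw 1 [← simMap_simMapInv hρ.ne' (d := d) j x]
    rw [simMap, simMap, add_sub_add_right_eq_sub, mul_sub]
  rw [mem_preimage, Metric.mem_closedBall, Metric.mem_closedBall, Real.dist_eq, Real.dist_eq, h,
    abs_mul, abs_of_pos hρ, mul_le_mul_iff_right₀ hρ]

theorem simMap_mapsTo_cthickening (hρ : 0 < ρ) {K : Set ℝ} (hK : IsSelfSimilarSet ρ d K) {r : ℝ}
    (hr : 0 ≤ r) (j : Fin (m + 1)) :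
    MapsTo (simMap ρ d j) (Metric.cthickening r K) (Metric.cthickening (ρ * r) K) := by
  rw [hK.2.1.cthickening_eq_biUnion_closedBall hr,
    hK.2.1.cthickening_eq_biUnion_closedBall (mul_nonneg hρ.le hr)]
  intro y hy
  obtain ⟨x, hx, hyx⟩ := mem_iUnion₂.1 hy
  refine mem_iUnion₂.2 ⟨simMap ρ d j x, hK.mapsTo_simMap j hx, ?_⟩
  rwa [← mem_preimage, simMap_preimage_closedBall hρ, simMapInv_simMap hρ.ne']

theorem transfer_simMapInv_pow_comp_sub (hρ : ρ ≠ 0) (a : ℝ) (g : ℝ → ℝ) (n : ℕ) (x : ℝ) :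
    (transfer (simMapInv ρ d) p ^ n) (fun y => g (y - a)) x =
      (transfer (simMapInv ρ d) p ^ n) g (x - ρ ^ n * a) := by
  induction n generalizing x with
  | zero => simp
  | succ n ih =>
    simp only [transfer_pow_succ_apply]
    refine Finset.sum_congr rfl fun j _ => ?_
    have h : simMapInv ρ d j (x - ρ ^ (n + 1) * a) = simMapInv ρ d j x - ρ ^ n * a := by
      unfold simMapInv
      field_simp
      ring
    rw [ih, h]

namespace IsSelfSimilarMeasure

variable {μ : Measure ℝ} (hμ : IsSelfSimilarMeasure ρ d p μ) (hp : ∀ j, 0 ≤ p j)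
include hμ hp

theorem measure_le_of_mapsTo (hp1 : ∑ j, p j = 1) {A B : Set ℝ} (hB : MeasurableSet B)
    (h : ∀ j, MapsTo (simMap ρ d j) A B) : μ A ≤ μ B := by
  have hsum : ∑ j, ENNReal.ofReal (p j) = 1 := by
    rw [← ENNReal.ofReal_sum_of_nonneg fun j _ => hp j, hp1, ENNReal.ofReal_one]
  calc μ A = ∑ j, ENNReal.ofReal (p j) * μ A := by rw [← Finset.sum_mul, hsum, one_mul]
    _ ≤ ∑ j, ENNReal.ofReal (p j) * μ (simMap ρ d j ⁻¹' B) :=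
      Finset.sum_le_sum fun j _ => mul_le_mul_right (measure_mono (h j)) _
    _ = μ B := (hμ B hB).symm

theorem measure_cthickening_le_measure [IsFiniteMeasure μ] (hp1 : ∑ j, p j = 1) (hρ0 : 0 < ρ)
    (hρ1 : ρ < 1) {K : Set ℝ} (hK : IsSelfSimilarSet ρ d K) {r : ℝ} (hr : 0 ≤ r) :
    μ (Metric.cthickening r K) ≤ μ K := by
  have hshrink : ∀ n : ℕ, μ (Metric.cthickening r K) ≤ μ (Metric.cthickening (ρ ^ n * r) K) := by
    intro n
    induction n with
    | zero => simp
    | succ n ih =>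
      rw [pow_succ', mul_assoc]
      exact ih.trans (hμ.measure_le_of_mapsTo hp hp1 Metric.isClosed_cthickening.measurableSet
        (simMap_mapsTo_cthickening hρ0 hK (by positivity)))
  have hzero : Tendsto (fun n : ℕ => ρ ^ n * r) atTop (𝓝 0) := by
    simpa using (tendsto_pow_atTop_nhds_zero_of_lt_one hρ0.le hρ1).mul_const r
  exact ge_of_tendsto' ((tendsto_measure_cthickening_of_isClosed
    ⟨1, one_pos, measure_ne_top _ _⟩ hK.2.1.isClosed).comp hzero) hshrink

theorem ae_mem [IsFiniteMeasure μ] (hp1 : ∑ j, p j = 1) (hρ0 : 0 < ρ) (hρ1 : ρ < 1) {K : Set ℝ}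
    (hK : IsSelfSimilarSet ρ d K) : ∀ᵐ x ∂μ, x ∈ K := by
  obtain ⟨x₀, hx₀⟩ := hK.1
  have hmono : Monotone fun n : ℕ => Metric.cthickening (n : ℝ) K := fun i j hij =>
    Metric.cthickening_mono (Nat.cast_le.2 hij) K
  have hunion : ⋃ n : ℕ, Metric.cthickening (n : ℝ) K = univ := by
    rw [← univ_subset_iff, ← Metric.iUnion_closedBall_nat x₀]
    exact iUnion_mono fun n => Metric.closedBall_subset_cthickening hx₀ n
  rw [ae_mem_iff_measure_eq hK.2.1.measurableSet.nullMeasurableSet]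
  refine (measure_mono (subset_univ K)).antisymm ?_
  rw [← hunion, hmono.measure_iUnion]
  exact iSup_le fun n => hμ.measure_cthickening_le_measure hp hp1 hρ0 hρ1 hK n.cast_nonneg

theorem real_eq_sum [IsFiniteMeasure μ] {E : Set ℝ} (hE : MeasurableSet E) :
    μ.real E = ∑ j, p j * μ.real (simMap ρ d j ⁻¹' E) := by
  rw [measureReal_def, hμ E hE, ENNReal.toReal_sum fun j _ =>
    ENNReal.mul_ne_top ENNReal.ofReal_ne_top (measure_ne_top _ _)]
  exact Finset.sum_congr rfl fun j _ => by
    rw [ENNReal.toReal_mul, ENNReal.toReal_ofReal (hp j), measureReal_def]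

theorem real_closedBall_pow_mul [IsFiniteMeasure μ] (hρ : 0 < ρ) (n : ℕ) (x r : ℝ) :
    μ.real (Metric.closedBall x (ρ ^ n * r)) =
      (transfer (simMapInv ρ d) p ^ n) (fun y => μ.real (Metric.closedBall y r)) x := by
  induction n generalizing x with
  | zero => simp
  | succ n ih =>
    rw [hμ.real_eq_sum hp Metric.isClosed_closedBall.measurableSet, transfer_pow_succ_apply]
    refine Finset.sum_congr rfl fun j _ => ?_
    rw [← ih, pow_succ', mul_assoc, simMap_preimage_closedBall hρ]

end IsSelfSimilarMeasure

variable {μ : Measure ℝ}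

theorem indicator_Ico_le_real_closedBall_one [IsProbabilityMeasure μ]
    (hae : ∀ᵐ x ∂μ, x ∈ Icc (0 : ℝ) 1) :
    (Ico (0 : ℝ) 1).indicator 1 ≤ fun y => μ.real (Metric.closedBall y 1) := by
  refine indicator_le' (fun y hy => ?_) fun _ _ => measureReal_nonneg
  have hfull : ∀ᵐ x ∂μ, x ∈ Metric.closedBall y 1 := by
    filter_upwards [hae] with x hx
    rw [Metric.mem_closedBall, Real.dist_eq]
    exact abs_le.2 ⟨by linarith [hx.1, hy.2], by linarith [hx.2, hy.1]⟩
  have hone : μ.real (Metric.closedBall y 1) = 1 :=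
    (measureReal_congr (eventuallyEq_univ.2 hfull)).trans probReal_univ
  exact hone.ge

theorem real_closedBall_one_le_sum_indicator_Ico [IsProbabilityMeasure μ]
    (hae : ∀ᵐ x ∂μ, x ∈ Icc (0 : ℝ) 1) (y : ℝ) :
    μ.real (Metric.closedBall y 1) ≤
      ∑ i ∈ Finset.Icc (-1 : ℤ) 2, (Ico (0 : ℝ) 1).indicator 1 (y - i) := by
  have hnonneg : ∀ i ∈ Finset.Icc (-1 : ℤ) 2, (0 : ℝ) ≤ (Ico (0 : ℝ) 1).indicator 1 (y - i) :=
    fun i _ => indicator_nonneg (fun _ _ => zero_le_one) _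
  by_cases hy : y ∈ Icc (-1 : ℝ) 2
  · have hfloor : ⌊y⌋ ∈ Finset.Icc (-1 : ℤ) 2 := Finset.mem_Icc.2
      ⟨Int.le_floor.2 (by simpa using hy.1), Int.floor_le_iff.2 (by push_cast; linarith [hy.2])⟩
    calc μ.real (Metric.closedBall y 1) ≤ 1 := measureReal_le_one
      _ = (Ico (0 : ℝ) 1).indicator 1 (y - ⌊y⌋) := by
        have hfract : y - ⌊y⌋ ∈ Ico (0 : ℝ) 1 := ⟨Int.fract_nonneg y, Int.fract_lt_one y⟩
        rw [indicator_of_mem hfract, Pi.one_apply]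
      _ ≤ _ := Finset.single_le_sum hnonneg hfloor
  · have hnull : μ (Metric.closedBall y 1) = 0 := by
      refine measure_mono_null (t := (Icc 0 1)ᶜ) (fun x hx hx01 => hy ?_) hae
      rw [Metric.mem_closedBall, Real.dist_eq, abs_le] at hx
      exact ⟨by linarith [hx.2, hx01.1], by linarith [hx.1, hx01.2]⟩
    rw [measureReal_def, hnull, ENNReal.toReal_zero]
    exact Finset.sum_nonneg hnonneg

namespace IsSelfSimilarMeasure

variable [IsProbabilityMeasure μ] (hμ : IsSelfSimilarMeasure ρ d p μ) (hρ : 0 < ρ)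
  (hae : ∀ᵐ x ∂μ, x ∈ Icc (0 : ℝ) 1)
include hμ hρ hae

theorem coverWeight_le_real_closedBall (hp : ∀ j, 0 ≤ p j) (n : ℕ) (x : ℝ) :
    coverWeight (simMapInv ρ d) p (Ico 0 1) n x ≤ μ.real (Metric.closedBall x (ρ ^ n)) := by
  rw [← mul_one (ρ ^ n), hμ.real_closedBall_pow_mul hp hρ]
  exact transfer_pow_mono hp n (indicator_Ico_le_real_closedBall_one hae) x

theorem real_closedBall_le_sum_coverWeight (hp : ∀ j, 0 ≤ p j) (n : ℕ) (x : ℝ) :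
    μ.real (Metric.closedBall x (ρ ^ n)) ≤ ∑ i ∈ Finset.Icc (-1 : ℤ) 2,
      coverWeight (simMapInv ρ d) p (Ico 0 1) n (x - ρ ^ n * i) := by
  calc μ.real (Metric.closedBall x (ρ ^ n))
      = (transfer (simMapInv ρ d) p ^ n) (fun y => μ.real (Metric.closedBall y 1)) x := by
        rw [← hμ.real_closedBall_pow_mul hp hρ, mul_one]
    _ ≤ (transfer (simMapInv ρ d) p ^ n) (∑ i ∈ Finset.Icc (-1 : ℤ) 2,
          fun y => (Ico (0 : ℝ) 1).indicator 1 (y - i)) x :=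
        transfer_pow_mono hp n (fun y => by
          simpa using real_closedBall_one_le_sum_indicator_Ico hae y) x
    _ = _ := by
        rw [map_sum, Finset.sum_apply]
        exact Finset.sum_congr rfl fun i _ => transfer_simMapInv_pow_comp_sub hρ.ne' _ _ _ _

theorem pow_mul_real_closedBall_le {q : ℝ} (hq : 0 ≤ q) (hqp : ∀ j, q ≤ p j)
    (hK : IsSelfSimilarSet ρ d (Icc 0 1)) {n : ℕ} {x y M : ℝ}
    (hxy : |x - y| ≤ ρ ^ n) (hM : 0 ≤ M)
    (hnear : ∀ z ∈ Ico (0 : ℝ) 1, |z - y| ≤ 3 * ρ ^ n →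
      coverWeight (simMapInv ρ d) p (Ico 0 1) n z ≤
        M * coverWeight (simMapInv ρ d) p (Ico 0 1) n y) (k : ℕ) :
    q ^ k * μ.real (Metric.closedBall x (ρ ^ n)) ≤
      4 * M * μ.real (Metric.closedBall y (ρ ^ (n + k))) := by
  have hp : ∀ j, 0 ≤ p j := fun j => hq.trans (hqp j)
  set W := coverWeight (simMapInv ρ d) p (Ico 0 1)
  have hterm : ∀ i ∈ Finset.Icc (-1 : ℤ) 2, W n (x - ρ ^ n * i) ≤ M * W n y := by
    intro i hi
    by_cases hz : x - ρ ^ n * i ∈ Ico (0 : ℝ) 1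
    · refine hnear _ hz ?_
      have hi2 : |(i : ℝ)| ≤ 2 := by
        rw [Finset.mem_Icc] at hi
        exact_mod_cast abs_le.2 ⟨by lia, hi.2⟩
      calc |x - ρ ^ n * i - y| = |x - y - ρ ^ n * i| := by rw [sub_right_comm]
        _ ≤ |x - y| + |ρ ^ n * i| := abs_sub _ _
        _ = |x - y| + ρ ^ n * |(i : ℝ)| := by rw [abs_mul, abs_of_pos (pow_pos hρ n)]
        _ ≤ ρ ^ n + ρ ^ n * 2 := by gcongr
        _ = 3 * ρ ^ n := by ring
    · rw [show W n (x - ρ ^ n * i) = 0 from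
        coverWeight_eq_zero (hK.mem_Ico_of_simMapInv_mem hρ) n hz]
      exact mul_nonneg hM (coverWeight_nonneg hp n y)
  have hsum : μ.real (Metric.closedBall x (ρ ^ n)) ≤ 4 * (M * W n y) :=
    (hμ.real_closedBall_le_sum_coverWeight hρ hae hp n x).trans
      ((Finset.sum_le_card_nsmul _ _ _ hterm).trans_eq (by simp))
  calc q ^ k * μ.real (Metric.closedBall x (ρ ^ n))
      ≤ q ^ k * (4 * (M * W n y)) := mul_le_mul_of_nonneg_left hsum (pow_nonneg hq k)
    _ = 4 * M * (q ^ k * W n y) := by ring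
    _ ≤ 4 * M * W (n + k) y := mul_le_mul_of_nonneg_left
        (pow_mul_coverWeight_le hq hqp (hK.exists_simMapInv_mem_Ico hρ) n k y) (by positivity)
    _ ≤ 4 * M * μ.real (Metric.closedBall y (ρ ^ (n + k))) := mul_le_mul_of_nonneg_left
        (hμ.coverWeight_le_real_closedBall hρ hae hp (n + k) y) (by positivity)

end IsSelfSimilarMeasure

end SelfSimilarMeasure

section LogDoubling

/-- `μ` is doubling up to the `K`-th power of a logarithm: for small `R` and `r < R`, the measures
of concentric balls of radii `R` and `r` centred in the support have ratio at most a constant times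
`|log R| ^ K * (R / r) ^ s`. -/
def IsLogDoubling {X : Type*} [PseudoMetricSpace X] [MeasurableSpace X] (μ : Measure X) (s : ℝ)
    (K : ℕ) : Prop :=
  ∃ C : ℝ, 0 < C ∧ ∀ᶠ R in 𝓝[>] (0 : ℝ), ∀ x ∈ μ.support, ∀ r ∈ Ioo 0 R,
    μ.real (Metric.ball x R) ≤
      C * |Real.log R| ^ K * (R / r) ^ s * μ.real (Metric.ball x r)

variable {ρ q : ℝ}

theorem exists_pow_lt_le_pow_add (hρ0 : 0 < ρ) (hρ1 : ρ < 1) {r R : ℝ} (hr : 0 < r) (hrR : r < R)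
    (hR : R ≤ 1) : ∃ n k : ℕ, R ≤ ρ ^ n ∧ ρ ^ (n + k) < r ∧ ρ ^ 2 * r ≤ ρ ^ k * R := by
  have hR0 : 0 < R := hr.trans hrR
  obtain ⟨n, hnR, hRn⟩ := exists_nat_pow_near_of_lt_one hR0 hR hρ0 hρ1
  obtain ⟨l, hlr, hrl⟩ := exists_nat_pow_near_of_lt_one hr (hrR.le.trans hR) hρ0 hρ1
  have hnl : n < l + 1 :=
    (pow_lt_pow_iff_right_of_lt_one₀ hρ0 hρ1).1 (hlr.trans (hrR.trans_le hRn))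
  obtain ⟨k, hk⟩ := Nat.exists_eq_add_of_le hnl.le
  refine ⟨n, k, hRn, hk ▸ hlr, le_of_mul_le_mul_left ?_ (pow_pos hρ0 n)⟩
  calc ρ ^ n * (ρ ^ 2 * r) = ρ * (ρ ^ (n + 1) * r) := by ring
    _ ≤ ρ * (R * ρ ^ l) := by gcongr
    _ = ρ ^ (l + 1) * R := by ring
    _ = ρ ^ n * (ρ ^ k * R) := by rw [hk, pow_add, mul_assoc]

theorem one_add_div_le_mul_abs_log (hρ0 : 0 < ρ) (hρ1 : ρ < 1) (hq : 0 < q) {n : ℕ} {R : ℝ}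
    (hR : R ∈ Ioc 0 (Real.exp (-1))) (hRn : R ≤ ρ ^ n) :
    1 + n / q ≤ (1 + 1 / (q * |Real.log ρ|)) * |Real.log R| := by
  have hρlog : Real.log ρ < 0 := Real.log_neg hρ0 hρ1
  have hRlog : Real.log R ≤ -1 := (Real.log_le_iff_le_exp hR.1).2 hR.2
  have hn : n * |Real.log ρ| ≤ |Real.log R| := by
    have h := Real.log_le_log hR.1 hRn
    rw [Real.log_pow] at h
    rw [abs_of_neg hρlog, abs_of_neg (by linarith)]
    linarith
  have hρabs : 0 < |Real.log ρ| := abs_pos.2 hρlog.ne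
  calc 1 + n / q = 1 + 1 / (q * |Real.log ρ|) * (n * |Real.log ρ|) := by field_simp
    _ ≤ |Real.log R| + 1 / (q * |Real.log ρ|) * |Real.log R| := by
      gcongr
      rw [abs_of_neg (by linarith)]
      linarith
    _ = _ := by ring

theorem sq_le_pow_mul_rpow_logb (hρ0 : 0 < ρ) (hρ1 : ρ < 1) (hq0 : 0 < q) (hq1 : q ≤ 1) {k : ℕ}
    {t : ℝ} (ht : 0 ≤ t) (h : ρ ^ 2 ≤ ρ ^ k * t) : q ^ 2 ≤ q ^ k * t ^ Real.logb ρ q := by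
  have hs : 0 ≤ Real.logb ρ q := Real.logb_nonneg_of_base_lt_one hρ0 hρ1 hq0 hq1
  have hpow : ∀ i : ℕ, (ρ ^ i) ^ Real.logb ρ q = q ^ i := fun i => by
    rw [← Real.rpow_pow_comm hρ0.le, Real.rpow_logb hρ0 hρ1.ne hq0]
  calc q ^ 2 = (ρ ^ 2) ^ Real.logb ρ q := (hpow 2).symm
    _ ≤ (ρ ^ k * t) ^ Real.logb ρ q := Real.rpow_le_rpow (by positivity) h hs
    _ = q ^ k * t ^ Real.logb ρ q := by rw [Real.mul_rpow (by positivity) ht, hpow]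

theorem IsLogDoubling.of_forall_real_closedBall_pow_le {X : Type*} [PseudoMetricSpace X]
    [MeasurableSpace X] {μ : Measure X} [IsFiniteMeasure μ] (hρ0 : 0 < ρ) (hρ1 : ρ < 1)
    (hq0 : 0 < q) (hq1 : q ≤ 1) {M : ℝ} (hM : 0 < M) (K : ℕ) {t : Set X}
    (ht : μ.support ⊆ closure t)
    (h : ∀ (n k : ℕ) (x y : X), y ∈ t → dist x y ≤ ρ ^ n →
      q ^ k * μ.real (Metric.closedBall x (ρ ^ n)) ≤
        M * (1 + n / q) ^ K * μ.real (Metric.closedBall y (ρ ^ (n + k)))) :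
    IsLogDoubling μ (Real.logb ρ q) K := by
  set A := 1 + 1 / (q * |Real.log ρ|)
  have hA : 0 < A := by positivity
  refine ⟨M * A ^ K / q ^ 2, by positivity, ?_⟩
  filter_upwards [Ioc_mem_nhdsGT (Real.exp_pos (-1))] with R hR x hx r hr
  have hR1 : R ≤ 1 := hR.2.trans (Real.exp_le_one_iff.2 (by norm_num))
  obtain ⟨n, k, hRn, hkr, hk⟩ := exists_pow_lt_le_pow_add hρ0 hρ1 hr.1 hr.2 hR1
  obtain ⟨y, hyt, hxy⟩ := Metric.mem_closure_iff.1 (ht hx) _ (sub_pos.2 hkr)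
  have hxy' : dist x y ≤ ρ ^ n := by linarith [pow_pos hρ0 (n + k), hr.2]
  have hbig : μ.real (Metric.ball x R) ≤ μ.real (Metric.closedBall x (ρ ^ n)) :=
    measureReal_mono
      (Metric.ball_subset_closedBall.trans (Metric.closedBall_subset_closedBall hRn))
  have hsmall : μ.real (Metric.closedBall y (ρ ^ (n + k))) ≤ μ.real (Metric.ball x r) :=
    measureReal_mono (Metric.closedBall_subset_ball' (by rw [dist_comm]; linarith))
  have hpow : q ^ 2 ≤ q ^ k * (R / r) ^ Real.logb ρ q :=
    sq_le_pow_mul_rpow_logb hρ0 hρ1 hq0 hq1 (div_nonneg hR.1.le hr.1.le) <| by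
      rwa [mul_div_assoc', le_div_iff₀ hr.1]
  have hRr : 0 ≤ (R / r) ^ Real.logb ρ q := Real.rpow_nonneg (div_nonneg hR.1.le hr.1.le) _
  refine le_of_mul_le_mul_left ?_ (pow_pos hq0 2)
  calc q ^ 2 * μ.real (Metric.ball x R)
      ≤ q ^ k * (R / r) ^ Real.logb ρ q * μ.real (Metric.closedBall x (ρ ^ n)) := by gcongr
    _ = (R / r) ^ Real.logb ρ q * (q ^ k * μ.real (Metric.closedBall x (ρ ^ n))) := by ring
    _ ≤ (R / r) ^ Real.logb ρ q *
          (M * (1 + n / q) ^ K * μ.real (Metric.closedBall y (ρ ^ (n + k)))) :=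
      mul_le_mul_of_nonneg_left (h n k x y hyt hxy') hRr
    _ ≤ (R / r) ^ Real.logb ρ q *
          (M * (A * |Real.log R|) ^ K * μ.real (Metric.ball x r)) := by
      gcongr
      exact one_add_div_le_mul_abs_log hρ0 hρ1 hq0 hR hRn
    _ = q ^ 2 * (M * A ^ K / q ^ 2 * |Real.log R| ^ K * (R / r) ^ Real.logb ρ q *
          μ.real (Metric.ball x r)) := by
      rw [mul_pow]
      field_simp

theorem IsSelfSimilarMeasure.exists_isLogDoubling {m : ℕ} {d p : Fin (m + 1) → ℝ}
    {μ : Measure ℝ} [IsProbabilityMeasure μ] (hμ : IsSelfSimilarMeasure ρ d p μ) (hρ0 : 0 < ρ)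
    (hρ1 : ρ < 1) (hd : Function.Injective d) (hK : IsSelfSimilarSet ρ d (Icc 0 1))
    (hft : IsFiniteType ρ d (Icc 0 1)) (hp : ∀ j, 0 < p j) (hp1 : ∑ j, p j = 1)
    (hreg : IsRegular d p) : ∃ s K, IsLogDoubling μ s K := by
  have hp0 : ∀ j, 0 ≤ p j := fun j => (hp j).le
  obtain ⟨q, hq0, hqp, hjump⟩ := hK.exists_agreeUpTo_coverWeight hρ0 hd hreg hp hp1
  obtain ⟨N, hN⟩ := hft.exists_encard_levelEndpoints_le hρ0
  have hq1 : q ≤ 1 := (hqp 0).trans <|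
    hp1 ▸ Finset.single_le_sum (fun j _ => hp0 j) (Finset.mem_univ 0)
  have hae : ∀ᵐ x ∂μ, x ∈ Icc (0 : ℝ) 1 := hμ.ae_mem hp0 hp1 hρ0 hρ1 hK
  have hsupp : μ.support ⊆ closure (Ico 0 1) := by
    rw [closure_Ico zero_ne_one]
    exact Measure.support_subset_of_isClosed isClosed_Icc hae
  refine ⟨Real.logb ρ q, 3 * N, .of_forall_real_closedBall_pow_le hρ0 hρ1 hq0 hq1 four_pos _ hsupp
    fun n k x y hy hxy => ?_⟩
  have hD : 1 ≤ 1 + n / q := le_add_of_nonneg_right (by positivity)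
  exact hμ.pow_mul_real_closedBall_le hρ0 hae hq0.le hqp hK hxy (by positivity)
    (fun z hz hzy => (agreeUpTo_coverWeight_of_abs_sub_le hρ0 hp0 hD (hjump n) (hN n) 3 hz hy
      (by exact_mod_cast hzy)).1) k

end LogDoubling

/-! ### Upper dimensions -/

section UpperPhiDim

theorem tendsto_log_abs_log_div_abs_log :
    Tendsto (fun x => Real.log |Real.log x| / |Real.log x|) (𝓝[>] 0) (𝓝 0) :=
  Real.isLittleO_log_id_atTop.tendsto_div_nhds_zero.comp
    (tendsto_abs_atBot_atTop.comp Real.tendsto_log_nhdsGT_zero)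

theorem abs_log_pow_le_div_rpow {β φ r R : ℝ} {K : ℕ} (hβ : 0 ≤ β) (hR : R ∈ Ioo 0 1) (hr : 0 < r)
    (hrR : r < R ^ (1 + φ)) (h : K * (Real.log |Real.log R| / |Real.log R|) ≤ β * φ) :
    |Real.log R| ^ K ≤ (R / r) ^ β := by
  have hRlog : Real.log R < 0 := Real.log_neg hR.1 hR.2
  have hL : 0 < |Real.log R| := abs_pos.2 hRlog.ne
  have hφ : φ * |Real.log R| ≤ Real.log (R / r) := by
    have hlog := Real.log_le_log hr hrR.le
    rw [Real.log_rpow hR.1] at hlog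
    rw [Real.log_div hR.1.ne' hr.ne', abs_of_neg hRlog]
    linarith
  rw [← Real.log_le_log_iff (pow_pos hL K) (Real.rpow_pos_of_pos (div_pos hR.1 hr) β),
    Real.log_pow, Real.log_rpow (div_pos hR.1 hr)]
  calc K * Real.log |Real.log R|
      = K * (Real.log |Real.log R| / |Real.log R|) * |Real.log R| := by field_simp
    _ ≤ β * φ * |Real.log R| := by gcongr
    _ = β * (φ * |Real.log R|) := mul_assoc _ _ _
    _ ≤ β * Real.log (R / r) := by gcongr

variable {X : Type*} [PseudoMetricSpace X] [MeasurableSpace X] {μ : Measure X} {Φ Ψ : ℝ → ℝ}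

theorem IsLogDoubling.add_mem_upperPhiExponents {s β : ℝ} {K : ℕ} (h : IsLogDoubling μ s K)
    (hβ : 0 ≤ β) (hΦ : ∀ᶠ R in 𝓝[>] (0 : ℝ),
      K * (Real.log |Real.log R| / |Real.log R|) ≤ β * Φ R) :
    s + β ∈ upperPhiExponents Φ μ := by
  obtain ⟨C, hC, hlog⟩ := h
  obtain ⟨u, hu, hsmall⟩ := mem_nhdsGT_iff_exists_Ioc_subset.1 (hlog.and hΦ)
  refine ⟨u, C, hu, hC, fun r R hr hrR hRR hR hRu x hx => ?_⟩
  obtain ⟨hball, hφ⟩ := hsmall ⟨hR.1, hRu⟩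
  have hRr : 0 < R / r := div_pos hR.1 hr
  refine div_le_of_le_mul₀ measureReal_nonneg (by positivity)
    ((hball x hx r ⟨hr, hrR.trans_le hRR⟩).trans ?_)
  calc C * |Real.log R| ^ K * (R / r) ^ s * μ.real (Metric.ball x r)
      ≤ C * (R / r) ^ β * (R / r) ^ s * μ.real (Metric.ball x r) := by
        gcongr
        exact abs_log_pow_le_div_rpow hβ hR hr hrR hφ
    _ = C * (R / r) ^ (s + β) * μ.real (Metric.ball x r) := by
        rw [Real.rpow_add hRr]
        ring

theorem rpow_one_add_le_rpow_one_add {x a b : ℝ} (hx : x ∈ Ioo 0 1) (hab : a ≤ b) :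
    x ^ (1 + b) ≤ x ^ (1 + a) :=
  Real.rpow_le_rpow_of_exponent_ge hx.1 hx.2.le (add_le_add_right hab 1)

theorem rpow_one_add_le_self {x a : ℝ} (hx : x ∈ Ioo 0 1) (ha : 0 ≤ a) : x ^ (1 + a) ≤ x :=
  Real.rpow_le_self_of_le_one hx.1.le hx.2.le (le_add_of_nonneg_right ha)

theorem tendsto_div_rpow_nhdsGT_zero {R α : ℝ} (hR : 0 < R) (hα : α < 0) :
    Tendsto (fun r => (R / r) ^ α) (𝓝[>] 0) (𝓝 0) := by
  have hdiv : Tendsto (fun r : ℝ => R / r) (𝓝[>] 0) atTop := by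
    simpa only [div_eq_mul_inv] using tendsto_inv_nhdsGT_zero.const_mul_atTop hR
  simpa only [neg_neg, Function.comp_def] using (tendsto_rpow_neg_atTop (neg_pos.2 hα)).comp hdiv

theorem nonneg_of_mem_upperPhiExponents [IsFiniteMeasure μ] (hμ : μ.support.Nonempty)
    (hΦ : ∀ x ∈ Ioo (0 : ℝ) 1, 0 ≤ Φ x) {α : ℝ} (hα : α ∈ upperPhiExponents Φ μ) : 0 ≤ α := by
  obtain ⟨C₁, C₂, hC₁, -, h⟩ := hα
  obtain ⟨x, hx⟩ := hμ
  by_contra! hneg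
  obtain ⟨R, hR0, hRlt⟩ := exists_between (lt_min hC₁ one_pos)
  have hR : R ∈ Ioo (0 : ℝ) 1 := ⟨hR0, hRlt.trans_le (min_le_right _ _)⟩
  have hRle : R ^ (1 + Φ R) ≤ R := rpow_one_add_le_self hR (hΦ R hR)
  have hlim : Tendsto (fun r => C₂ * (R / r) ^ α) (𝓝[>] 0) (𝓝 0) := by
    simpa only [mul_zero] using (tendsto_div_rpow_nhdsGT_zero hR0 hneg).const_mul C₂
  obtain ⟨r, hlt, hr, hrR⟩ := ((hlim.eventually (gt_mem_nhds one_pos)).and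
    (Ioo_mem_nhdsGT (Real.rpow_pos_of_pos hR0 (1 + Φ R)))).exists
  have hpos : 0 < μ.real (Metric.ball x r) := ENNReal.toReal_pos
    ((Measure.mem_support_iff_forall x).1 hx _ (Metric.ball_mem_nhds x hr)).ne'
    (measure_ne_top _ _)
  have hone : 1 ≤ μ.real (Metric.ball x R) / μ.real (Metric.ball x r) :=
    (one_le_div hpos).2 (measureReal_mono (Metric.ball_subset_ball (hrR.le.trans hRle)))
  exact hlt.not_ge (hone.trans (h r R hr hrR hRle hR (hRlt.le.trans (min_le_left _ _)) x hx))

theorem upperPhiDim_nonneg [IsFiniteMeasure μ] (hμ : μ.support.Nonempty)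
    (hΦ : ∀ x ∈ Ioo (0 : ℝ) 1, 0 ≤ Φ x) : 0 ≤ upperPhiDim Φ μ :=
  le_sInf <| forall_mem_image.2 fun _ hα =>
    EReal.coe_nonneg.2 (nonneg_of_mem_upperPhiExponents hμ hΦ hα)

theorem upperPhiDim_le {α : ℝ} (hα : α ∈ upperPhiExponents Φ μ) : upperPhiDim Φ μ ≤ α :=
  sInf_le (mem_image_of_mem _ hα)

theorem IsLogDoubling.upperPhiDim_const_le {s : ℝ} {K : ℕ} (h : IsLogDoubling μ s K) {ε : ℝ}
    (hε : 0 < ε) : upperPhiDim (fun _ => ε) μ ≤ (s + 1 : ℝ) := by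
  refine upperPhiDim_le (h.add_mem_upperPhiExponents zero_le_one ?_)
  have hlim := tendsto_log_abs_log_div_abs_log.const_mul (K : ℝ)
  rw [mul_zero] at hlim
  exact hlim.eventually_le_const (by rwa [one_mul])

theorem upperPhiDim_anti (hΦ : ∀ x ∈ Ioo (0 : ℝ) 1, 0 ≤ Φ x)
    (h : ∀ x ∈ Ioo (0 : ℝ) 1, Φ x ≤ Ψ x) : upperPhiDim Ψ μ ≤ upperPhiDim Φ μ := by
  refine sInf_le_sInf (image_mono ?_)
  rintro α ⟨C₁, C₂, hC₁, hC₂, hα⟩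
  exact ⟨C₁, C₂, hC₁, hC₂, fun r R hr hrR _ hR hRC => hα r R hr
    (hrR.trans_le (rpow_one_add_le_rpow_one_add hR (h R hR)))
    (rpow_one_add_le_self hR (hΦ R hR)) hR hRC⟩

theorem exists_eq_coe_of_nonneg_of_le {a : EReal} {b : ℝ} (h0 : 0 ≤ a) (hb : a ≤ b) :
    ∃ t : ℝ, a = t :=
  ⟨a.toReal, (EReal.coe_toReal (hb.trans_lt (EReal.coe_lt_top b)).ne
    (EReal.bot_lt_zero.trans_le h0).ne').symm⟩

namespace IsLogDoubling

variable [IsFiniteMeasure μ] {s : ℝ} {K : ℕ} (h : IsLogDoubling μ s K) (hμ : μ.support.Nonempty)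
include h hμ

theorem exists_upperPhiDim_eq_coe (hΦ : ∀ x ∈ Ioo (0 : ℝ) 1, 0 ≤ Φ x)
    (hdom : DominatedOn (fun x => Real.log |Real.log x| / |Real.log x|) Φ (Ioo 0 1)) :
    ∃ t : ℝ, upperPhiDim Φ μ = t := by
  obtain ⟨c, hc, hdom⟩ := hdom
  refine exists_eq_coe_of_nonneg_of_le (upperPhiDim_nonneg hμ hΦ)
    (upperPhiDim_le (h.add_mem_upperPhiExponents (β := K * c) (by positivity) ?_))
  filter_upwards [Ioo_mem_nhdsGT one_pos] with R hR
  rw [mul_assoc]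
  exact mul_le_mul_of_nonneg_left (hdom R hR) K.cast_nonneg

theorem exists_hasQuasiAssouadDim : ∃ t : ℝ, HasQuasiAssouadDim μ t := by
  set D : ℝ → EReal := fun θ => upperPhiDim (fun _ => 1 / θ - 1) μ
  have hpos : ∀ θ ∈ Ioo (0 : ℝ) 1, 0 < 1 / θ - 1 := fun θ hθ =>
    sub_pos.2 (one_lt_one_div hθ.1 hθ.2)
  have hmono : MonotoneOn D (Ioo 0 1) := fun θ hθ θ' hθ' hθθ' =>
    upperPhiDim_anti (fun _ _ => (hpos θ' hθ').le)
      fun _ _ => sub_le_sub_right (one_div_le_one_div_of_le hθ.1 hθθ') 1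
  have hhalf : (1 / 2 : ℝ) ∈ Ioo (0 : ℝ) 1 := ⟨one_half_pos, one_half_lt_one⟩
  obtain ⟨t, ht⟩ := exists_eq_coe_of_nonneg_of_le (a := sSup (D '' Ioo 0 1))
    ((upperPhiDim_nonneg hμ fun _ _ => (hpos _ hhalf).le).trans
      (le_sSup (mem_image_of_mem D hhalf)))
    (sSup_le (forall_mem_image.2 fun θ hθ => h.upperPhiDim_const_le (hpos θ hθ)))
  exact ⟨t, ht ▸ hmono.tendsto_nhdsWithin_Ioo_left ⟨_, hhalf⟩ (OrderTop.bddAbove _)⟩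

end IsLogDoubling

end UpperPhiDim

end PhiDim

theorem mainTheorem11 (m : ℕ) (hm : 1 ≤ m) (ρ : ℝ) (hρ0 : 0 < ρ) (hρ1 : ρ < 1)
    (d : Fin (m + 1) → ℝ) (hd : Function.Injective d)
    (hK : PhiDim.IsSelfSimilarSet ρ d (Icc 0 1))
    (hft : PhiDim.IsFiniteType ρ d (Icc 0 1))
    (p : Fin (m + 1) → ℝ) (hp : ∀ j, 0 < p j) (hp1 : ∑ j, p j = 1)
    (hreg : PhiDim.IsRegular d p)
    (μ : Measure ℝ) [IsProbabilityMeasure μ] (hμ : PhiDim.IsSelfSimilarMeasure ρ d p μ) :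
    (∀ Φ : ℝ → ℝ, PhiDim.IsDimensionFunction Φ →
      PhiDim.DominatedOn (fun x => Real.log |Real.log x| / |Real.log x|) Φ (Ioo 0 1) →
      ∃ t : ℝ, PhiDim.upperPhiDim Φ μ = (t : EReal)) ∧
    ∃ t : ℝ, PhiDim.HasQuasiAssouadDim μ (t : EReal) := by
  obtain ⟨s, K, hlog⟩ := hμ.exists_isLogDoubling hρ0 hρ1 hd hK hft hp hp1 hreg
  have hne : μ.support.Nonempty := Measure.nonempty_support (IsProbabilityMeasure.ne_zero μ)
  exact ⟨fun Φ hΦ hdom => hlog.exists_upperPhiDim_eq_coe hne hΦ.nonneg hdom,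
    hlog.exists_hasQuasiAssouadDim hne⟩
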